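/- **Setting.** For a finite graph $G=(V,E)$ and vertex covers $\alpha,\beta$ of $G$, a *schedule* of length $\ell$ and cost $s$ from $\alpha$ to $\beta$ is a sequence $V_0=\alpha,V_1,\dots,V_\ell=\beta$ of vertex covers of $G$ such that, for all $0\le i<\ell$, $|V_i\cup V_{i+1}|\le s$ and the symmetric difference $V_i\oplus V_{i+1}$ is an independent set. It is *monotone* if each vertex lies in at most one of the sets $V_i\oplus V_{i+1}$, and it is an *$\eta$-approximation* if its cost is at most $\eta\max\{|\alpha|,|\beta|\}$. The *reduction graph* of a graph with positive integer vertex weights $w$ is obtained by replacing each vertex $v$ by $w(v)$ copies and each edge $uv$ by a complete bipartite graph between the copies of $u$ and the copies of $v$. In the (deterministic) $\mathsf{LOCAL}$ model, the nodes of the graph have distinct IDs from a given finite ID space; initially each node knows its own ID, the IDs of its neighbours, and whether it is in $\alpha$ and whether it is in $\beta$; in each synchronous round it sends a message of unbounded size to each of its neighbours. The algorithm may depend on $n$ and on the ID space, and at the end each node outputs its membership in each $V_i$. **Theorem.** For every $\varepsilon\in(0,1)$ and every $t:\mathbb N\to\mathbb N$ with $t(n)=o(n)$ there is a family $\mathcal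 G$ of unweighted graphs, each of which is the reduction graph of a cycle with positive integer weights, such that $\mathcal G$ contains an $n$-node graph for every large enough $n$, and the following hold. 1. For every large enough $n$, every $n$-node graph $G\in\mathcal G$ admits, for every pair $\alpha,\beta$ of vertex covers of $G$, a monotone $(1+\varepsilon)$-approximation schedule from $\alpha$ to $\beta$. 2. For all constants $C,c>0$, every large enough $n$ (depending on $C$ and $c$), and every ID space of size at least $c\,n^2$, no deterministic $t(n)$-round $\mathsf{LOCAL}$ algorithm computes, for every $n$-node graph $G\in\mathcal G$, every pair of vertex covers $\alpha,\beta$ of $G$ and every assignment of distinct IDs, a monotone $(2-\varepsilon)$-approximation schedule from $\alpha$ to $\beta$ of length at most $C\,n$. -/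

import Mathlib

open Filter Asymptotics

namespace VCReconfig

section Schedules

variable {V : Type} [Fintype V] [DecidableEq V]

/-- `S 0, S 1, …, S ℓ` is a reconfiguration schedule of length `ℓ` and cost `s` in `G`, from the
vertex cover `α` to the vertex cover `β`. Only the first `ℓ + 1` terms of `S` are relevant. -/
structure IsSchedule (G : SimpleGraph V) (α β : Finset V) (ℓ s : ℕ) (S : ℕ → Finset V) :
    Prop where
  cover : ∀ i ≤ ℓ, G.IsVertexCover (S i : Set V)
  start : S 0 = α
  finish : S ℓ = β
  cost : ∀ i < ℓ, (S i ∪ S (i + 1)).card ≤ s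
  indep : ∀ i < ℓ, G.IsIndepSet (symmDiff (S i) (S (i + 1)) : Finset V)

/-- Every vertex is changed (added or removed) at most once in `S 0, …, S ℓ`. -/
def IsMonotone (ℓ : ℕ) (S : ℕ → Finset V) : Prop :=
  ∀ v : V, ∀ i < ℓ, ∀ j < ℓ,
    v ∈ symmDiff (S i) (S (i + 1)) → v ∈ symmDiff (S j) (S (j + 1)) → i = j

/-- `S 0, …, S ℓ` is an `(η, c)`-approximation schedule from `α` to `β`: its cost is at most
`η * max |α| |β| + c`. -/
def IsApproxSchedule (G : SimpleGraph V) (α β : Finset V) (η c : ℝ) (ℓ : ℕ)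
    (S : ℕ → Finset V) : Prop :=
  ∃ s : ℕ, IsSchedule G α β ℓ s S ∧ (s : ℝ) ≤ η * (max α.card β.card : ℕ) + c

end Schedules

/-- The reduction graph of the weighted graph `(G, w)`: each vertex `v` is replaced by `w v` copies,
and each edge `uv` by a complete bipartite graph between the copies of `u` and the copies of `v`. -/
def reductionGraph {V : Type} (G : SimpleGraph V) (w : V → ℕ) :
    SimpleGraph (Σ v : V, Fin (w v)) where
  Adj x y := G.Adj x.1 y.1
  symm := ⟨fun _ _ h => SimpleGraph.Adj.symm h⟩
  loopless := ⟨fun _ h => G.irrefl h⟩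

/-- `H` is (isomorphic to) the reduction graph of a cycle with positive integer weights. -/
def IsWeightedCycleReduction {V : Type} (H : SimpleGraph V) : Prop :=
  ∃ (m : ℕ) (w : Fin m → ℕ), 3 ≤ m ∧ (∀ v, 0 < w v) ∧
    Nonempty (H ≃g reductionGraph (SimpleGraph.cycleGraph m) w)

/-- A deterministic message passing algorithm of the LOCAL model for vertex cover reconfiguration,
with IDs in `Id`. States and messages are unrestricted. A node starts with its own ID, the set of
the IDs of its neighbours, and the two bits telling whether it belongs to `α` and to `β`. (If the
IDs of the neighbours are not wanted, `init` may ignore them.) In each round it sends one message to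
each neighbour (which may depend on the ID of that neighbour), and then updates its state according
to the messages received, each of which comes with the ID of its sender. From its final state, a node
reads off, for each `i`, whether it belongs to the `i`-th set of the schedule. As an algorithm is
used for one size `n` of the network and one ID space only, it may depend on them arbitrarily. -/
structure LocalAlgorithm (Id : Type) where
  State : Type
  Msg : Type
  init : Id → Set Id → Bool → Bool → State
  send : State → Id → Msg
  update : State → Set (Id × Msg) → State
  output : State → ℕ → Bool

namespace LocalAlgorithm

variable {Id V : Type} [Fintype V] [DecidableEq V]

/-- The state of the node `v` after the given number of rounds. -/
def state (A : LocalAlgorithm Id) (G : SimpleGraph V) (α β : Finset V) (ids : V → Id) :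
    ℕ → V → A.State
  | 0, v => A.init (ids v) (ids '' {u | G.Adj v u}) (decide (v ∈ α)) (decide (v ∈ β))
  | r + 1, v => A.update (A.state G α β ids r v)
      {p | ∃ u, G.Adj v u ∧ p = (ids u, A.send (A.state G α β ids r u) (ids v))}

/-- The sets computed by the nodes after `T` rounds. -/
def schedule (A : LocalAlgorithm Id) (G : SimpleGraph V) (α β : Finset V) (ids : V → Id) (T : ℕ) :
    ℕ → Finset V :=
  fun i => Finset.univ.filter fun v => A.output (A.state G α β ids T v) i = true

/-- Within `T` rounds, the algorithm computes a monotone `(η, c)`-approximation schedule of length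
at most `L`, for every graph in `𝒢`, every pair of vertex covers of it, and every assignment of
distinct IDs to its nodes. -/
def ComputesMonotone (A : LocalAlgorithm Id) (T : ℕ) (η c L : ℝ) (𝒢 : Set (SimpleGraph V)) :
    Prop :=
  ∀ G ∈ 𝒢, ∀ α β : Finset V, G.IsVertexCover (α : Set V) → G.IsVertexCover (β : Set V) →
    ∀ ids : V → Id, Function.Injective ids →
      ∃ ℓ : ℕ, (ℓ : ℝ) ≤ L ∧ IsApproxSchedule G α β η c ℓ (A.schedule G α β ids T) ∧
        IsMonotone ℓ (A.schedule G α β ids T)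

end LocalAlgorithm

end VCReconfig

/-! The graphs are cycles of `K = 2 ^ j` blocks, with `K` constant. A block has two adjacent heavy
positions of weight `W` in its middle, padded on both sides by about `t` light positions. One more
position absorbs the remainder, so that every large `n` occurs; light nodes are an `O(ε)` fraction
because `t n = o(n)`.

Upper bound: sweep once around the cycle, replacing `α` by `β`. By the cycle lemma `exists_rotation`
some starting point keeps the prefix exchanges below `max |α| |β|`, and the sweep costs at most
three positions, `3 * W`, on top (`exists_monotone_schedule`). Every cover has at least `K * W`
nodes, so `3 ≤ ε * K` makes this overhead affordable.

Lower bound: let `α` omit the second heavy positions and `β` the first. In each block some set of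
the schedule contains both heavy positions (`exists_superset_of_isSchedule`). After `t` rounds the
heavy nodes know only their own block (`state_eq_of_local`), so the earliest such time is a colour
of the set of IDs placed on the block, with `O(n)` colours. A Kneser-type argument
(`exists_pairwise_disjoint_same_color`) gives `K` disjoint ID sets of one colour; placed on the
blocks, they fill all blocks simultaneously, at cost at least `2 * K * W`. Each step needs only
linearly many IDs in `n`, so quadratically many suffice. -/

namespace VCReconfig

/-! ### Disjoint sets of the same colour. -/

/-- Few subsets of a finite type have less than `s` elements. -/
lemma card_filter_card_lt_mul_le {α : Type*} [Fintype α] [DecidableEq α] (s : ℕ) :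
    (Finset.univ.filter fun Y : Finset α => Y.card < s).card * 8 ^ Fintype.card α
      ≤ 8 ^ s * 9 ^ Fintype.card α := by
  -- Binomial expansion of `(1 + 8) ^ N`: each set with fewer than `s` elements contributes at least
  -- `8 ^ (N - s)`.
  have h9 : (9 : ℕ) ^ Fintype.card α
      = ∑ Y : Finset α, 1 ^ Y.card * 8 ^ (Fintype.card α - Y.card) := by
    rw [Fintype.sum_pow_mul_eq_add_pow]
  rw [h9, Finset.mul_sum, Finset.card_eq_sum_ones, Finset.sum_mul, Finset.sum_filter]
  refine Finset.sum_le_sum fun Y _ => ?_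
  split_ifs with hY
  · rw [one_mul, one_pow, one_mul, ← pow_add]
    exact Nat.pow_le_pow_right (by norm_num) (by have := Y.card_le_univ; omega)
  · exact Nat.zero_le _

/-- A weak form of Kneser's theorem. -/
lemma exists_disjoint_of_card_univ {α : Type*} [Fintype α] [DecidableEq α] {s T : ℕ}
    (hN : 6 * (s + T) + 1 ≤ Fintype.card α) (f : Finset α → ℕ)
    (hf : ∀ X : Finset α, X.card = s → f X < T) :
    ∃ X Y : Finset α, X.card = s ∧ Y.card = s ∧ Disjoint X Y ∧ f X = f Y := by
  by_contra! hcon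
  set N := Fintype.card α with hNdef
  -- The up-set generated by colour `i`. Without disjoint `s`-sets of the same colour it is an
  -- intersecting family, and `T` such families cover at most `2 ^ N - 2 ^ (N - T)` sets. They cover
  -- all sets with at least `s` elements, so at least `2 ^ (N - T)` sets are smaller than `s`, which
  -- is too many.
  let F : ℕ → Finset (Finset α) := fun i =>
    Finset.univ.filter fun Y => ∃ X ⊆ Y, X.card = s ∧ f X = i
  have hF : ∀ i ∈ Finset.range T, (F i : Set (Finset α)).Intersecting := by
    intro i _ Y hY Z hZ hd
    simp only [F, Finset.coe_filter, Finset.mem_univ, true_and, Set.mem_ofPred_eq] at hY hZ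
    obtain ⟨X, hXY, hX, rfl⟩ := hY
    obtain ⟨X', hXZ, hX', he⟩ := hZ
    exact hcon X X' hX hX' (Finset.disjoint_of_subset_left hXY
      (Finset.disjoint_of_subset_right hXZ hd)) he.symm
  have : Nonempty α := Fintype.card_pos_iff.1 (by omega)
  have h1 := Finset.card_biUnion_le_of_intersecting (Finset.range T) F hF
  rw [Finset.card_range, ← hNdef] at h1
  have h2 : (Finset.univ.filter fun Y : Finset α => ¬ Y.card < s) ⊆ (Finset.range T).biUnion F := by
    intro Y hY
    simp only [Finset.mem_filter, Finset.mem_univ, true_and, not_lt] at hY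
    obtain ⟨X, hXY, hX⟩ := Finset.exists_subset_card_eq hY
    simp only [Finset.mem_biUnion, Finset.mem_range, F, Finset.mem_filter, Finset.mem_univ,
      true_and]
    exact ⟨f X, hf X hX, X, hXY, hX, rfl⟩
  have h3 := (Finset.card_le_card h2).trans h1
  have h4 := Finset.card_filter_add_card_filter_not (s := (Finset.univ : Finset (Finset α)))
    (fun Y : Finset α => Y.card < s)
  rw [Finset.card_univ, Fintype.card_finset, ← hNdef] at h4
  have h5 : 2 ^ (N - T) ≤ 2 ^ N := Nat.pow_le_pow_right (by norm_num) (Nat.sub_le _ _)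
  have h6 : 2 ^ (N - T) ≤ (Finset.univ.filter fun Y : Finset α => Y.card < s).card := by
    omega
  have h7 := (Nat.mul_le_mul_right (8 ^ N) h6).trans (card_filter_card_lt_mul_le s)
  -- Squaring allows `9 ^ 2 < 2 ^ 7`, which leaves only powers of two to compare.
  have h8 : (2 ^ (N - T) * 8 ^ N) ^ 2 ≤ (8 ^ s * 9 ^ N) ^ 2 := Nat.pow_le_pow_left h7 2
  have h9 : (8 ^ s * 9 ^ N) ^ 2 < (8 ^ s) ^ 2 * 128 ^ N := by
    rw [mul_pow, ← pow_mul 9, mul_comm N 2, pow_mul 9]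
    exact Nat.mul_lt_mul_of_pos_left (Nat.pow_lt_pow_left (by norm_num) (by omega)) (by positivity)
  have h10 := h8.trans_lt h9
  rw [show (8 : ℕ) = 2 ^ 3 by norm_num, show (128 : ℕ) = 2 ^ 7 by norm_num, ← pow_mul, ← pow_mul,
    ← pow_mul, ← pow_mul, ← pow_add, ← pow_mul, ← pow_add] at h10
  have h11 := (Nat.pow_lt_pow_iff_right (by norm_num)).1 h10
  omega

lemma exists_disjoint_subsets {α : Type*} [DecidableEq α] {s T : ℕ} {Z : Finset α}
    (hZ : 6 * (s + T) + 1 ≤ Z.card) (f : Finset α → ℕ)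
    (hf : ∀ X : Finset α, X.card = s → f X < T) :
    ∃ X Y : Finset α, X ⊆ Z ∧ Y ⊆ Z ∧ X.card = s ∧ Y.card = s ∧ Disjoint X Y ∧ f X = f Y := by
  obtain ⟨X, Y, hX, hY, hd, he⟩ := exists_disjoint_of_card_univ (α := Z) (s := s) (T := T)
    (by simpa using hZ) (fun X => f (X.map (Function.Embedding.subtype _)))
    (fun X hX => hf _ (by simpa using hX))
  refine ⟨_, _, Finset.map_subtype_subset X, Finset.map_subtype_subset Y, by simpa using hX,
    by simpa using hY, ?_, he⟩
  exact (Finset.disjoint_map _).2 hd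

/-- In a colouring of the `s`-element sets with `T` colours, there are `2 ^ j` pairwise disjoint sets
of the same colour, as soon as the ground set is large enough, linearly in `s + T`. -/
lemma exists_pairwise_disjoint_same_color {α : Type*} [DecidableEq α] {T : ℕ} (j : ℕ) :
    ∀ (s : ℕ) (f : Finset α → ℕ), (∀ X : Finset α, X.card = s → f X < T) →
      ∀ Z : Finset α, 7 ^ j * (s + T + 1) ≤ Z.card →
      ∃ (F : ℕ → Finset α) (c : ℕ), (∀ i < 2 ^ j, (F i).card = s ∧ f (F i) = c) ∧
        ∀ i < 2 ^ j, ∀ i' < 2 ^ j, i ≠ i' → Disjoint (F i) (F i') := by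
  induction j with
  | zero =>
    intro s f hf Z hZ
    obtain ⟨X, -, hX⟩ := Finset.exists_subset_card_eq (s := Z) (n := s) (by omega)
    exact ⟨fun _ => X, f X, fun _ _ => ⟨hX, rfl⟩, fun i hi i' hi' h => by omega⟩
  | succ j ih =>
    intro s f hf Z hZ
    have hpair : ∀ Y : Finset α, ∃ p : Finset α × Finset α, Y.card = 6 * (s + T) + 1 →
        p.1 ⊆ Y ∧ p.2 ⊆ Y ∧ p.1.card = s ∧ p.2.card = s ∧ Disjoint p.1 p.2 ∧ f p.1 = f p.2 := by
      intro Y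
      by_cases hY : Y.card = 6 * (s + T) + 1
      · obtain ⟨A, B, h⟩ := exists_disjoint_subsets hY.ge f hf
        exact ⟨(A, B), fun _ => h⟩
      · exact ⟨(∅, ∅), fun h => absurd h hY⟩
    choose p hp using hpair
    -- Each larger set is coloured by the common colour of a disjoint pair inside it; splitting the
    -- sets found by induction into these pairs doubles their number.
    obtain ⟨F, c, hF, hdis⟩ := ih (6 * (s + T) + 1) (fun Y => f (p Y).1)
      (fun Y hY => hf _ (hp Y hY).2.2.1) Z
      (by refine le_trans ?_ hZ; rw [pow_succ, mul_assoc]; exact Nat.mul_le_mul_left _ (by omega))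
    have hdiv : ∀ i, i < 2 ^ (j + 1) → i / 2 < 2 ^ j := fun i hi => by
      rw [pow_succ] at hi; omega
    refine ⟨fun i => if i % 2 = 0 then (p (F (i / 2))).1 else (p (F (i / 2))).2, c, ?_, ?_⟩
    · intro i hi
      obtain ⟨h1, h2⟩ := hF _ (hdiv i hi)
      have h3 := hp _ h1
      dsimp only
      split_ifs
      · exact ⟨h3.2.2.1, h2⟩
      · exact ⟨h3.2.2.2.1, h3.2.2.2.2.2 ▸ h2⟩
    · intro i hi i' hi' hne
      have h3 := hp _ (hF _ (hdiv i hi)).1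
      have h3' := hp _ (hF _ (hdiv i' hi')).1
      dsimp only
      by_cases he : i / 2 = i' / 2
      · rw [he] at h3 ⊢
        split_ifs with h h' h'
        · omega
        · exact h3.2.2.2.2.1
        · exact h3.2.2.2.2.1.symm
        · omega
      · have hd := hdis _ (hdiv i hi) _ (hdiv i' hi') he
        refine Finset.disjoint_of_subset_left ?_ (Finset.disjoint_of_subset_right ?_ hd)
        · split_ifs
          exacts [h3.1, h3.2.1]
        · split_ifs
          exacts [h3'.1, h3'.2.1]

/-! ### Monotone schedules by a sweep around the cycle. -/

lemma cycleGraph_adj_iff_val {m : ℕ} (hm : 2 ≤ m) {u v : Fin m} :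
    (SimpleGraph.cycleGraph m).Adj u v ↔ u.val + 1 = v.val ∨ v.val + 1 = u.val ∨
      (u.val = 0 ∧ v.val + 1 = m) ∨ (v.val = 0 ∧ u.val + 1 = m) := by
  have hsub : ∀ a b : Fin m, (a - b).val = if b.val ≤ a.val then a.val - b.val
      else m - b.val + a.val := by
    intro a b
    rw [Fin.val_sub]
    have ha := a.isLt
    have hb := b.isLt
    split_ifs with h
    · rw [show m - b.val + a.val = m + (a.val - b.val) by omega, Nat.add_mod_left,
        Nat.mod_eq_of_lt (by omega)]
    · exact Nat.mod_eq_of_lt (by omega)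
  rw [SimpleGraph.cycleGraph_adj', hsub, hsub]
  have hu := u.isLt
  have hv := v.isLt
  split_ifs <;> omega

lemma card_filter_eq_sum {V : Type*} (s : Finset V) (p : V → Prop) [DecidablePred p] :
    ((s.filter p).card : ℤ) = ∑ x ∈ s, if p x then 1 else 0 := by
  rw [Finset.card_filter]
  push_cast
  rfl

/-- The cycle lemma: a cyclic sweep which replaces `α` by `β` position after position can be started
at a place where the sizes of the intermediate sets never exceed `max |α| |β|`. -/
lemma exists_rotation {V : Type*} [DecidableEq V] {m : ℕ} (π : V → ℕ)
    (hπ : ∀ x, π x < m) (α β : Finset V) :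
    ∃ r ≤ m, ∀ j, (β.filter fun x => (if r ≤ π x then π x - r else π x + m - r) < j).card +
      (α.filter fun x => j ≤ (if r ≤ π x then π x - r else π x + m - r)).card
        ≤ max α.card β.card := by
  -- The net growth after exchanging the first `j` positions. Starting at a maximum of `D`, the
  -- sweep stays below `|α|` until it wraps around, and below `|β|` afterwards.
  let D : ℕ → ℤ := fun j => ((β.filter fun x => π x < j).card : ℤ) -
    ((α.filter fun x => π x < j).card : ℤ)
  obtain ⟨r, hr, hmax⟩ := Finset.exists_max_image (Finset.range (m + 1)) D ⟨0, by simp⟩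
  have hrm : r ≤ m := by simpa [Nat.lt_succ_iff] using hr
  refine ⟨r, hrm, fun j => ?_⟩
  set ρ : V → ℕ := fun x => if r ≤ π x then π x - r else π x + m - r with hρ
  have hcard : ∀ s : Finset V, (s.card : ℤ) = ∑ x ∈ s, 1 := by simp
  have hα : ((α.filter fun x => j ≤ ρ x).card : ℤ) + (α.filter fun x => ρ x < j).card
      = α.card := by
    rw [card_filter_eq_sum, card_filter_eq_sum, ← Finset.sum_add_distrib, hcard]
    exact Finset.sum_congr rfl fun x _ => by split_ifs <;> omega
  by_cases hjm : r + j ≤ m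
  · have key : ∀ s : Finset V, ((s.filter fun x => ρ x < j).card : ℤ) +
        (s.filter fun x => π x < r).card = (s.filter fun x => π x < r + j).card := by
      intro s
      rw [card_filter_eq_sum, card_filter_eq_sum, card_filter_eq_sum, ← Finset.sum_add_distrib]
      refine Finset.sum_congr rfl fun x _ => ?_
      have := hπ x
      simp only [hρ]
      split_ifs <;> omega
    have h1 := hmax (r + j) (by simp; omega)
    have h2 := key α
    have h3 := key β
    simp only [D] at h1
    have : ((β.filter fun x => ρ x < j).card : ℤ) + (α.filter fun x => j ≤ ρ x).card
      ≤ α.card := by linarith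
    exact le_max_of_le_left (by exact_mod_cast this)
  · by_cases hj : j ≤ m
    · have key : ∀ s : Finset V, ((s.filter fun x => ρ x < j).card : ℤ) +
          (s.filter fun x => π x < r).card
            = s.card + (s.filter fun x => π x < r + j - m).card := by
        intro s
        rw [card_filter_eq_sum, card_filter_eq_sum, card_filter_eq_sum, ← Finset.sum_add_distrib,
          hcard, ← Finset.sum_add_distrib]
        refine Finset.sum_congr rfl fun x _ => ?_
        have := hπ x
        simp only [hρ]
        split_ifs <;> omega
      have h1 := hmax (r + j - m) (by simp; omega)
      have h2 := key α
      have h3 := key β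
      simp only [D] at h1
      have : ((β.filter fun x => ρ x < j).card : ℤ) + (α.filter fun x => j ≤ ρ x).card
        ≤ β.card := by linarith
      exact le_max_of_le_right (by exact_mod_cast this)
    · have h0 : (α.filter fun x => j ≤ ρ x) = ∅ := by
        refine Finset.filter_eq_empty_iff.2 fun x _ => ?_
        have := hπ x
        simp only [hρ]
        split_ifs <;> omega
      rw [h0, Finset.card_empty, add_zero]
      exact le_max_of_le_right (Finset.card_filter_le _ _)

section Sweep

variable {V : Type} [Fintype V] [DecidableEq V]

/-- The sets in which every vertex of the symmetric difference of `α` and `β` is changed once, the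
vertex `x` between the times `τ x` and `τ x + 1`. -/
def switchAt (α β : Finset V) (τ : V → ℕ) (i : ℕ) : Finset V :=
  Finset.univ.filter fun x => if τ x < i then x ∈ β else x ∈ α

lemma mem_switchAt {α β : Finset V} {τ : V → ℕ} {i : ℕ} {x : V} :
    x ∈ switchAt α β τ i ↔ if τ x < i then x ∈ β else x ∈ α := by
  simp [switchAt]

lemma eq_of_mem_symmDiff_switchAt {α β : Finset V} {τ : V → ℕ} {i : ℕ} {x : V}
    (h : x ∈ symmDiff (switchAt α β τ i) (switchAt α β τ (i + 1))) :
    τ x = i ∧ ¬ (x ∈ α ↔ x ∈ β) := by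
  rw [Finset.mem_symmDiff, mem_switchAt, mem_switchAt] at h
  by_cases h1 : τ x < i
  · simp [h1, Nat.lt_succ_of_lt h1] at h
  · by_cases h2 : τ x < i + 1
    · simp only [h1, h2, if_true, if_false] at h
      exact ⟨by omega, by tauto⟩
    · simp [h1, h2] at h

lemma isMonotone_switchAt (α β : Finset V) (τ : V → ℕ) (ℓ : ℕ) :
    IsMonotone ℓ (switchAt α β τ) := fun _ _ _ _ _ hi hj =>
  (eq_of_mem_symmDiff_switchAt hi).1.symm.trans (eq_of_mem_symmDiff_switchAt hj).1

/-- Sweeping once around the cycle. -/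
lemma exists_monotone_schedule_of_sweep (G : SimpleGraph V) {m : ℕ} (ρ : V → ℕ)
    (hρ : ∀ x, ρ x < m)
    (hadj : ∀ x y, G.Adj x y → ρ x + 1 = ρ y ∨ ρ y + 1 = ρ x ∨ (ρ x = 0 ∧ ρ y + 1 = m) ∨
      (ρ y = 0 ∧ ρ x + 1 = m))
    {W : ℕ} (hW : ∀ p, (Finset.univ.filter fun x => ρ x = p).card ≤ W) {α β : Finset V}
    (hα : G.IsVertexCover (α : Set V)) (hβ : G.IsVertexCover (β : Set V)) {M : ℕ}
    (hM : ∀ j, (β.filter fun x => ρ x < j).card + (α.filter fun x => j ≤ ρ x).card ≤ M) :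
    ∃ (ℓ : ℕ) (S : ℕ → Finset V), IsSchedule G α β ℓ (M + 3 * W) S ∧ IsMonotone ℓ S := by
  -- A vertex outside `β` must leave after its neighbours have entered. Those at position `ρ x + 1`
  -- enter at time `2 * ρ x + 2`, hence the `3`; position `0` also has neighbours at the far end, so
  -- it waits for the end of the sweep.
  let τ : V → ℕ := fun x => if x ∈ β then 2 * ρ x else if ρ x = 0 then 2 * m + 2 else 2 * ρ x + 3
  have hτ : ∀ x, (x ∈ β → τ x = 2 * ρ x) ∧ (x ∉ β → ρ x = 0 → τ x = 2 * m + 2) ∧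
      (x ∉ β → ρ x ≠ 0 → τ x = 2 * ρ x + 3) := by
    intro x
    simp only [τ]
    refine ⟨fun h => if_pos h, fun h h' => ?_, fun h h' => ?_⟩ <;> simp [h, h']
  have hcov : ∀ {s : Finset V}, G.IsVertexCover (s : Set V) → ∀ {x y}, G.Adj x y → x ∈ s ∨ y ∈ s :=
    fun {s} h {x y} hxy => by simpa using h hxy
  refine ⟨2 * m + 3, switchAt α β τ, ⟨?_, ?_, ?_, ?_, ?_⟩, isMonotone_switchAt _ _ _ _⟩
  · intro i _ x y hxy
    have h1 := hcov hα hxy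
    have h2 := hcov hβ hxy
    have h3 := hadj x y hxy
    have hxm := hρ x
    have hym := hρ y
    rw [Finset.mem_coe, Finset.mem_coe, mem_switchAt, mem_switchAt]
    by_contra! hcon
    obtain ⟨hx0, hy0⟩ := hcon
    have key : ∀ {x y : V}, x ∉ β → τ x < i → i ≤ τ y → y ∈ β → ρ x < m → ρ y < m →
        (ρ x + 1 = ρ y ∨ ρ y + 1 = ρ x ∨ (ρ x = 0 ∧ ρ y + 1 = m) ∨
          (ρ y = 0 ∧ ρ x + 1 = m)) → False := by
      intro x y hxβ hxi hyi hyβ hxm hym h3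
      have hy := (hτ y).1 hyβ
      by_cases h0 : ρ x = 0
      · have hx := (hτ x).2.1 hxβ h0
        omega
      · have hx := (hτ x).2.2 hxβ h0
        omega
    split_ifs at hx0 hy0 with hxi hyi hyi
    · exact h2.elim hx0 hy0
    · exact key hx0 hxi (not_lt.1 hyi) (h2.resolve_left hx0) hxm hym h3
    · exact key hy0 hyi (not_lt.1 hxi) (h2.resolve_right hy0) hym hxm (by tauto)
    · exact h1.elim hx0 hy0
  · ext x
    simp [mem_switchAt]
  · ext x
    have hx := hτ x
    have hxm := hρ x
    have : τ x < 2 * m + 3 := by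
      by_cases h1 : x ∈ β
      · have := hx.1 h1
        omega
      · by_cases h2 : ρ x = 0
        · have := hx.2.1 h1 h2
          omega
        · have := hx.2.2 h1 h2
          omega
    simp [mem_switchAt, this]
  · intro i _
    -- Compared with the exact prefix exchange, the only vertices still waiting to leave are at
    -- positions `0`, `i / 2` and `i / 2 - 1`.
    have hsub : switchAt α β τ i ∪ switchAt α β τ (i + 1) ⊆
        ((β.filter fun x => ρ x < i / 2 + 1) ∪ (α.filter fun x => i / 2 + 1 ≤ ρ x)) ∪
        ((Finset.univ.filter fun x => ρ x = 0) ∪ (Finset.univ.filter fun x => ρ x = i / 2) ∪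
          (Finset.univ.filter fun x => ρ x = i / 2 - 1)) := by
      intro x hx
      have h := hτ x
      simp only [Finset.mem_union, mem_switchAt, Finset.mem_filter, Finset.mem_univ,
        true_and] at hx ⊢
      by_cases hxβ : x ∈ β
      · have h1 := h.1 hxβ
        by_cases hxα : x ∈ α
        · simp only [hxα, hxβ, true_and]
          omega
        · simp only [hxα, hxβ, true_and, false_and, h1] at hx ⊢
          split_ifs at hx <;> simp at hx <;> omega
      · by_cases hxα : x ∈ α
        · by_cases h0 : ρ x = 0
          · simp [h0]
          · have h1 := h.2.2 hxβ h0
            simp only [hxα, hxβ, true_and, false_and, h1] at hx ⊢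
            split_ifs at hx <;> simp at hx <;> omega
        · simp [hxα, hxβ] at hx
    refine (Finset.card_le_card hsub).trans ((Finset.card_union_le _ _).trans ?_)
    have h1 := (Finset.card_union_le (β.filter fun x => ρ x < i / 2 + 1)
      (α.filter fun x => i / 2 + 1 ≤ ρ x)).trans (hM _)
    have h2 := Finset.card_union_le ((Finset.univ.filter fun x => ρ x = 0) ∪
      (Finset.univ.filter fun x => ρ x = i / 2)) (Finset.univ.filter fun x => ρ x = i / 2 - 1)
    have h3 := Finset.card_union_le (Finset.univ.filter fun x => ρ x = 0)
      (Finset.univ.filter fun x => ρ x = i / 2)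
    have h4 := hW 0
    have h5 := hW (i / 2)
    have h6 := hW (i / 2 - 1)
    omega
  · intro i _ x hx y hy _ hxy
    obtain ⟨hx1, hx2⟩ := eq_of_mem_symmDiff_switchAt (Finset.mem_coe.1 hx)
    obtain ⟨hy1, hy2⟩ := eq_of_mem_symmDiff_switchAt (Finset.mem_coe.1 hy)
    have h1 := hcov hα hxy
    have h2 := hcov hβ hxy
    -- Insertions happen at even times below `2 * m`, removals at odd times or at `2 * m + 2`, so no
    -- step mixes them. Vertices inserted together all avoid `α`, vertices removed together all
    -- avoid `β`, and neither kind contains an edge.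
    have key : ∀ {x y : V}, x ∉ β → τ x = i → τ y = i → y ∈ β → False := by
      intro x y hxβ hxi hyi hyβ
      have hy := (hτ y).1 hyβ
      by_cases h0 : ρ x = 0
      · have hx := (hτ x).2.1 hxβ h0
        have := hρ y
        omega
      · have hx := (hτ x).2.2 hxβ h0
        omega
    by_cases hxβ : x ∈ β
    · by_cases hyβ : y ∈ β
      · tauto
      · exact key hyβ hy1 hx1 hxβ
    · exact key hxβ hx1 hy1 (h2.resolve_left hxβ)

/-- Blow-ups of cycles admit monotone schedules whose cost exceeds the necessary one by at most
three times the size of the largest part. -/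
lemma exists_monotone_schedule (G : SimpleGraph V) {m : ℕ} (hm : 2 ≤ m) (π : V → Fin m)
    (hadj : ∀ x y, G.Adj x y → (SimpleGraph.cycleGraph m).Adj (π x) (π y)) {W : ℕ}
    (hW : ∀ p, (Finset.univ.filter fun x => π x = p).card ≤ W) {α β : Finset V}
    (hα : G.IsVertexCover (α : Set V)) (hβ : G.IsVertexCover (β : Set V)) :
    ∃ (ℓ : ℕ) (S : ℕ → Finset V),
      IsSchedule G α β ℓ (max α.card β.card + 3 * W) S ∧ IsMonotone ℓ S := by
  obtain ⟨r, hr, hrot⟩ := exists_rotation (fun x => (π x).val) (fun x => (π x).isLt) α β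
  refine exists_monotone_schedule_of_sweep G (m := m) _ ?_ ?_ ?_ hα hβ hrot
  · intro x
    have := (π x).isLt
    split_ifs <;> omega
  · intro x y hxy
    have h := (cycleGraph_adj_iff_val hm).1 (hadj x y hxy)
    have := (π x).isLt
    have := (π y).isLt
    split_ifs <;> omega
  · intro p
    by_cases hp : p < m
    · refine le_trans (Finset.card_le_card ?_)
        (hW ⟨(if p + r < m then p + r else p + r - m), by split_ifs <;> omega⟩)
      intro x hx
      have := (π x).isLt
      simp only [Finset.mem_filter, Finset.mem_univ, true_and, Fin.ext_iff] at hx ⊢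
      split_ifs at hx ⊢ <;> omega
    · rw [Finset.filter_eq_empty_iff.2]
      · simp
      · intro x _
        have := (π x).isLt
        split_ifs <;> omega

end Sweep

/-! ### The weighted cycle of blocks. -/

lemma reductionGraph_adj {V : Type} {G : SimpleGraph V} {w : V → ℕ} {x y : Σ v : V, Fin (w v)} :
    (reductionGraph G w).Adj x y ↔ G.Adj x.1 y.1 := Iff.rfl

/-- The weights in a block of `2 * t + 4` consecutive positions: two heavy positions in the middle. -/
def blockWeight (t W o : ℕ) : ℕ := if o = t + 1 ∨ o = t + 2 then W else 1

/-- The weights of a cycle of `K` blocks and one additional position of weight `r + 1`. -/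
def cycleWeight (K t W r : ℕ) (v : Fin (K * (2 * t + 4) + 1)) : ℕ :=
  if v.val < K * (2 * t + 4) then blockWeight t W (v.val % (2 * t + 4)) else r + 1

/-- The reduction graph of the weighted cycle of `K` blocks and an additional position. -/
abbrev blockCycle (K t W r : ℕ) :
    SimpleGraph (Σ v : Fin (K * (2 * t + 4) + 1), Fin (cycleWeight K t W r v)) :=
  reductionGraph (SimpleGraph.cycleGraph (K * (2 * t + 4) + 1)) (cycleWeight K t W r)

/-- The nodes of a single block. -/
abbrev Block (t W : ℕ) : Type := Σ o : Fin (2 * t + 4), Fin (blockWeight t W o)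

/-- The graph of a single block. -/
abbrev blockPath (t W : ℕ) : SimpleGraph (Block t W) :=
  reductionGraph (SimpleGraph.pathGraph (2 * t + 4)) fun o => blockWeight t W o

lemma blockWeight_pos {t W : ℕ} (hW : 0 < W) (o : ℕ) : 0 < blockWeight t W o := by
  unfold blockWeight
  split_ifs <;> omega

lemma sum_blockWeight (t W : ℕ) :
    ∑ o ∈ Finset.range (2 * t + 4), blockWeight t W o = 2 * W + 2 * t + 2 := by
  have h : ∀ o ∈ Finset.range (t + 1), blockWeight t W o = 1 := by
    intro o ho
    rw [Finset.mem_range] at ho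
    exact if_neg (by omega)
  have h' : ∀ o ∈ Finset.range (t + 1), blockWeight t W (t + 3 + o) = 1 := by
    intro o ho
    exact if_neg (by omega)
  rw [show 2 * t + 4 = t + 3 + (t + 1) by ring, Finset.sum_range_add, Finset.sum_range_succ,
    Finset.sum_range_succ, Finset.sum_congr rfl h, Finset.sum_congr rfl h']
  simp [blockWeight]
  ring

lemma card_block (t W : ℕ) : Fintype.card (Block t W) = 2 * W + 2 * t + 2 := by
  simp only [Fintype.card_sigma, Fintype.card_fin]
  rw [Fin.sum_univ_eq_sum_range (fun o => blockWeight t W o), sum_blockWeight]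

lemma sum_range_mul_mod (g : ℕ → ℕ) (K L : ℕ) :
    ∑ v ∈ Finset.range (K * L), g (v % L) = K * ∑ o ∈ Finset.range L, g o := by
  induction K with
  | zero => simp
  | succ K ih =>
    rw [Nat.succ_mul, Finset.sum_range_add, ih, Nat.succ_mul]
    congr 1
    refine Finset.sum_congr rfl fun o ho => ?_
    rw [Nat.mul_add_mod_self_right, Nat.mod_eq_of_lt (Finset.mem_range.1 ho)]

lemma card_blockCycle (K t W r : ℕ) :
    Fintype.card (Σ v : Fin (K * (2 * t + 4) + 1), Fin (cycleWeight K t W r v))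
      = K * (2 * W + 2 * t + 2) + (r + 1) := by
  simp only [Fintype.card_sigma, Fintype.card_fin]
  rw [Fin.sum_univ_castSucc, ← sum_blockWeight, ← sum_range_mul_mod, ← Fin.sum_univ_eq_sum_range
    (fun v => blockWeight t W (v % (2 * t + 4)))]
  simp [cycleWeight]

lemma cycleWeight_pos {K t W r : ℕ} (hW : 0 < W) (v) : 0 < cycleWeight K t W r v := by
  unfold cycleWeight
  split_ifs
  · exact blockWeight_pos hW _
  · omega

lemma cycleWeight_le {K t W r : ℕ} (hW : r + 1 ≤ W) (v) : cycleWeight K t W r v ≤ W := by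
  unfold cycleWeight blockWeight
  split_ifs <;> omega

lemma mul_add_lt {K L : ℕ} (k : Fin K) {o : ℕ} (ho : o < L) : k.val * L + o < K * L :=
  calc k.val * L + o < k.val * L + L := by omega
    _ = (k.val + 1) * L := by ring
    _ ≤ K * L := Nat.mul_le_mul_right _ k.isLt

lemma cycleWeight_block {K t : ℕ} (W r : ℕ) (k : Fin K) (o : Fin (2 * t + 4))
    (h : k.val * (2 * t + 4) + o.val < K * (2 * t + 4) + 1) :
    cycleWeight K t W r ⟨k.val * (2 * t + 4) + o.val, h⟩ = blockWeight t W o := by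
  unfold cycleWeight
  rw [if_pos (mul_add_lt k o.isLt), Nat.mul_add_mod_self_right, Nat.mod_eq_of_lt o.isLt]

/-- The inclusion of the `k`-th block. -/
def blockEmb {K t : ℕ} (W r : ℕ) (k : Fin K) (x : Block t W) :
    Σ v : Fin (K * (2 * t + 4) + 1), Fin (cycleWeight K t W r v) :=
  ⟨⟨k.val * (2 * t + 4) + x.1.val, Nat.lt_succ_of_lt (mul_add_lt k x.1.isLt)⟩,
    Fin.cast (cycleWeight_block W r k x.1 _).symm x.2⟩

lemma sigma_fin_ext {m : ℕ} {w : Fin m → ℕ} {x y : Σ v : Fin m, Fin (w v)}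
    (h1 : x.1.val = y.1.val) (h2 : x.2.val = y.2.val) : x = y := by
  obtain ⟨a, i⟩ := x
  obtain ⟨b, j⟩ := y
  obtain rfl : a = b := Fin.ext h1
  obtain rfl : i = j := Fin.ext h2
  rfl

lemma blockEmb_injective {K t W r : ℕ} :
    Function.Injective fun p : Fin K × Block t W => blockEmb W r p.1 p.2 := by
  rintro ⟨k, x⟩ ⟨k', x'⟩ h
  have h1 : k.val * (2 * t + 4) + x.1.val = k'.val * (2 * t + 4) + x'.1.val :=
    congrArg (fun z => z.1.val) h
  have h2 : x.2.val = x'.2.val := congrArg (fun z => z.2.val) h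
  have h3 : x.1.val = x'.1.val := by
    have := congrArg (· % (2 * t + 4)) h1
    simpa [Nat.mul_add_mod_self_right, Nat.mod_eq_of_lt x.1.isLt,
      Nat.mod_eq_of_lt x'.1.isLt] using this
  have h4 : k.val = k'.val := by
    rw [h3] at h1
    exact Nat.eq_of_mul_eq_mul_right (by omega) (Nat.add_right_cancel h1)
  exact Prod.ext (Fin.ext h4) (sigma_fin_ext h3 h2)

lemma blockCycle_adj_blockEmb {K t W r : ℕ} (k : Fin K) {x y : Block t W}
    (h : (blockPath t W).Adj x y) :
    (blockCycle K t W r).Adj (blockEmb W r k x) (blockEmb W r k y) := by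
  have hk := mul_add_lt k x.1.isLt
  rw [reductionGraph_adj, SimpleGraph.pathGraph_adj] at h
  rw [reductionGraph_adj, cycleGraph_adj_iff_val (by omega)]
  simp only [blockEmb]
  omega

/-- Only the two end positions of a block have neighbours outside it, so elsewhere a node cannot
distinguish the cycle from the isolated block within one step. -/
lemma exists_of_blockCycle_adj {K t W r : ℕ} (k : Fin K) {x : Block t W} (h0 : 1 ≤ x.1.val)
    (h1 : x.1.val + 2 ≤ 2 * t + 4) {u} (h : (blockCycle K t W r).Adj (blockEmb W r k x) u) :
    ∃ y, (blockPath t W).Adj x y ∧ blockEmb W r k y = u := by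
  have hk := mul_add_lt k (L := 2 * t + 4) (o := x.1.val + 1) (by omega)
  rw [reductionGraph_adj, cycleGraph_adj_iff_val (by omega)] at h
  simp only [blockEmb] at h
  obtain ⟨o, ho, hadj⟩ : ∃ o : Fin (2 * t + 4), u.1.val = k.val * (2 * t + 4) + o.val ∧
      (x.1.val + 1 = o.val ∨ o.val + 1 = x.1.val) := by
    rcases h with h | h | h | h
    · exact ⟨⟨x.1.val + 1, by omega⟩, by simp only; omega, by simp⟩
    · exact ⟨⟨x.1.val - 1, by omega⟩, by simp only; omega, by simp only; omega⟩
    · omega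
    · omega
  have hu : u.1 = ⟨k.val * (2 * t + 4) + o.val, Nat.lt_succ_of_lt (mul_add_lt k o.isLt)⟩ :=
    Fin.ext ho
  refine ⟨⟨o, Fin.cast (by rw [hu, cycleWeight_block]) u.2⟩, ?_, sigma_fin_ext ho.symm rfl⟩
  rw [reductionGraph_adj, SimpleGraph.pathGraph_adj]
  exact hadj

/-! ### Locality, and the crossing of a complete bipartite graph. -/

/-- Indistinguishability: `inner r x` provides that all nodes influencing `x` within `r` rounds lie
in the image of `ψ`. Since the initial state already contains the IDs of the neighbours,
neighbourhoods must lift even for `r = 0`. -/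
lemma state_eq_of_local {Id V B : Type} [DecidableEq V] [DecidableEq B]
    (A : LocalAlgorithm Id) (G : SimpleGraph V) (P : SimpleGraph B) (ψ : B → V)
    (inner : ℕ → B → Prop) (hinner : ∀ r x, inner (r + 1) x → inner r x ∧ ∀ y, P.Adj x y → inner r y)
    (hadj : ∀ x y, P.Adj x y → G.Adj (ψ x) (ψ y))
    (hlift : ∀ r x, inner r x → ∀ u, G.Adj (ψ x) u → ∃ y, P.Adj x y ∧ ψ y = u)
    (α β : Finset V) (α' β' : Finset B) (hα : ∀ x, ψ x ∈ α ↔ x ∈ α') (hβ : ∀ x, ψ x ∈ β ↔ x ∈ β')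
    (ids : V → Id) (r : ℕ) :
    ∀ x, inner r x → A.state G α β ids r (ψ x) = A.state P α' β' (ids ∘ ψ) r x := by
  induction r with
  | zero =>
    intro x hx
    have : ids '' {u | G.Adj (ψ x) u} = (ids ∘ ψ) '' {y | P.Adj x y} := by
      ext i
      constructor
      · rintro ⟨u, hu, rfl⟩
        obtain ⟨y, hy, rfl⟩ := hlift _ x hx u hu
        exact ⟨y, hy, rfl⟩
      · rintro ⟨y, hy, rfl⟩
        exact ⟨ψ y, hadj x y hy, rfl⟩
    simp only [LocalAlgorithm.state, this, hα, hβ, Function.comp_apply]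
  | succ r ih =>
    intro x hx
    obtain ⟨hx', hn⟩ := hinner r x hx
    simp only [LocalAlgorithm.state, ih x hx']
    congr 1
    ext p
    constructor
    · rintro ⟨u, hu, hp⟩
      obtain ⟨y, hy, rfl⟩ := hlift _ x hx u hu
      exact ⟨y, hy, by rw [hp, ih y (hn y hy)]; rfl⟩
    · rintro ⟨y, hy, hp⟩
      exact ⟨ψ y, hadj x y hy, by rw [hp, ih y (hn y hy)]; rfl⟩

/-- Injections defined on a part of a finite type can be extended. -/
lemma exists_injective_extension {ι V β : Type*} [Fintype V] [Fintype β] {φ : ι → V} {h : ι → β}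
    (hφ : Function.Injective φ) (hh : Function.Injective h)
    (hc : Fintype.card V ≤ Fintype.card β) :
    ∃ g : V → β, Function.Injective g ∧ g ∘ φ = h := by
  classical
  rcases isEmpty_or_nonempty β with hβ | ⟨⟨b⟩⟩
  · rw [Fintype.card_eq_zero (α := β), Nat.le_zero, Fintype.card_eq_zero_iff] at hc
    exact ⟨fun v => (hc.false v).elim, fun v => (hc.false v).elim, funext fun i => (hc.false (φ i)).elim⟩
  · have : Fintype ι := Fintype.ofInjective φ hφ
    have hf : ∀ i, Function.extend φ h (fun _ => b) (φ i) = h i := fun i => hφ.extend_apply _ _ _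
    have himg : (Finset.univ.image φ).image (Function.extend φ h fun _ => b)
        = Finset.univ.image h := by
      rw [Finset.image_image]
      exact Finset.image_congr fun i _ => hf i
    obtain ⟨u, hu, hcard⟩ := Finset.exists_superset_card_eq (s := Finset.univ.image h)
      (n := Fintype.card V) (by
        rw [Finset.card_image_of_injective _ hh, Finset.card_univ]
        exact Fintype.card_le_of_injective φ hφ) hc
    obtain ⟨g, hg⟩ := Finset.exists_equiv_extend_of_card_eq hcard.symm
      (s := Finset.univ.image φ) (f := Function.extend φ h fun _ => b) (himg ▸ hu) (by
        intro x hx y hy hxy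
        simp only [Finset.coe_image, Finset.coe_univ, Set.image_univ, Set.mem_range] at hx hy
        obtain ⟨i, rfl⟩ := hx
        obtain ⟨j, rfl⟩ := hy
        rw [hf, hf] at hxy
        rw [hh hxy])
    refine ⟨fun v => g v, fun x y hxy => g.injective (Subtype.ext hxy), funext fun i => ?_⟩
    simp only [Function.comp_apply]
    rw [hg _ (by simp), hf]

/-- If the complete bipartite graph between `P` and `Q` is in `G`, then a schedule from a set
containing `P` to a set that does not contain `P` passes through a superset of `P ∪ Q`. -/
lemma exists_superset_of_isSchedule {V : Type} [Fintype V] [DecidableEq V] {G : SimpleGraph V}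
    {α β : Finset V} {ℓ s : ℕ} {S : ℕ → Finset V} (hS : IsSchedule G α β ℓ s S) {P Q : Set V}
    (hPQ : ∀ x ∈ P, ∀ y ∈ Q, G.Adj x y) (hα : ∀ x ∈ P, x ∈ α) (hβ : ∃ x ∈ P, x ∉ β) :
    ∃ i < ℓ, ∀ x, x ∈ P ∨ x ∈ Q → x ∈ S i := by
  classical
  -- At the first step in which some `x ∈ P` leaves, all of `Q` must be present afterwards to cover
  -- the edges at `x`. No node of `Q` can enter in that same step, being adjacent to `x`, so `Q` was
  -- already present before.
  have hex : ∃ j, ∃ x ∈ P, x ∉ S j := ⟨ℓ, by rwa [hS.finish]⟩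
  have hj : Nat.find hex ≤ ℓ := Nat.find_min' hex (by rwa [hS.finish])
  obtain ⟨x, hxP, hx⟩ := Nat.find_spec hex
  obtain ⟨i, hi⟩ : ∃ i, Nat.find hex = i + 1 := by
    refine Nat.exists_eq_succ_of_ne_zero fun h0 => hx ?_
    rw [h0, hS.start]
    exact hα x hxP
  have hmin : ∀ y ∈ P, y ∈ S i := by
    have := Nat.find_min hex (m := i) (by omega)
    push Not at this
    exact this
  rw [hi] at hx hj
  refine ⟨i, hj, fun y hy => hy.elim (hmin y) fun hyQ => ?_⟩
  by_contra hyi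
  have hxy := hPQ x hxP y hyQ
  have hy1 : y ∈ S (i + 1) := by
    have := hS.cover (i + 1) hj hxy
    simpa [hx] using this
  exact hS.indep i hj (Finset.mem_coe.2 (Finset.mem_symmDiff.2 (Or.inl ⟨hmin x hxP, hx⟩)))
    (Finset.mem_coe.2 (Finset.mem_symmDiff.2 (Or.inr ⟨hy1, hyi⟩))) hxy.ne hxy

/-! ### Vertex covers of the cycle of blocks. -/

/-- The `c`-th copy of the first heavy position of a block. -/
def leftHeavy {t W : ℕ} (c : Fin W) : Block t W :=
  ⟨⟨t + 1, by omega⟩, Fin.cast (by simp [blockWeight]) c⟩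

/-- The `c`-th copy of the second heavy position of a block. -/
def rightHeavy {t W : ℕ} (c : Fin W) : Block t W :=
  ⟨⟨t + 2, by omega⟩, Fin.cast (by simp [blockWeight]) c⟩

lemma leftHeavy_injective {t W : ℕ} : Function.Injective (leftHeavy (t := t) (W := W)) :=
  fun _ _ h => Fin.ext (congrArg (fun z : Block t W => z.2.val) h)

lemma rightHeavy_injective {t W : ℕ} : Function.Injective (rightHeavy (t := t) (W := W)) :=
  fun _ _ h => Fin.ext (congrArg (fun z : Block t W => z.2.val) h)

lemma blockPath_adj_of_heavy {t W : ℕ} {x y : Block t W} (hx : x.1.val = t + 1)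
    (hy : y.1.val = t + 2) : (blockPath t W).Adj x y := by
  rw [reductionGraph_adj, SimpleGraph.pathGraph_adj]
  omega

section Cycle

variable {V : Type} {G : SimpleGraph V} {K t W r : ℕ}

lemma card_eq_of_iso [Fintype V] (e : G ≃g blockCycle K t W r) :
    Fintype.card V = K * (2 * W + 2 * t + 2) + (r + 1) := by
  rw [Fintype.card_congr e.toEquiv, card_blockCycle]

/-- The inclusion of the `k`-th block in an isomorphic copy of the cycle of blocks. -/
def isoBlockEmb (e : G ≃g blockCycle K t W r) (k : Fin K) (x : Block t W) : V :=
  e.symm (blockEmb W r k x)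

lemma isoBlockEmb_injective (e : G ≃g blockCycle K t W r) :
    Function.Injective fun p : Fin K × Block t W => isoBlockEmb e p.1 p.2 :=
  e.symm.injective.comp blockEmb_injective

lemma adj_isoBlockEmb (e : G ≃g blockCycle K t W r) (k : Fin K) {x y : Block t W}
    (h : (blockPath t W).Adj x y) : G.Adj (isoBlockEmb e k x) (isoBlockEmb e k y) :=
  e.symm.map_rel_iff.2 (blockCycle_adj_blockEmb k h)

lemma exists_of_adj_isoBlockEmb (e : G ≃g blockCycle K t W r) (k : Fin K) {x : Block t W}
    (h0 : 1 ≤ x.1.val) (h1 : x.1.val + 2 ≤ 2 * t + 4) {u : V} (h : G.Adj (isoBlockEmb e k x) u) :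
    ∃ y, (blockPath t W).Adj x y ∧ isoBlockEmb e k y = u := by
  have h' := e.map_rel_iff.2 h
  rw [isoBlockEmb, RelIso.apply_symm_apply] at h'
  obtain ⟨y, hy, hyu⟩ := exists_of_blockCycle_adj k h0 h1 h'
  exact ⟨y, hy, by rw [isoBlockEmb, hyu, RelIso.symm_apply_apply]⟩

variable [DecidableEq V]

/-- Every vertex cover contains at least half of the heavy nodes. -/
lemma mul_le_card_of_isVertexCover (e : G ≃g blockCycle K t W r) {α : Finset V}
    (hα : G.IsVertexCover (α : Set V)) : K * W ≤ α.card := by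
  -- Equally numbered copies of the two heavy positions form a matching of `K * W` edges; `φ`
  -- selects a covered end of each.
  let φ : Fin K × Fin W → Block t W := fun p =>
    if isoBlockEmb e p.1 (leftHeavy p.2) ∈ α then leftHeavy p.2 else rightHeavy p.2
  have hcopy : ∀ p, (φ p).2.val = p.2.val := by
    intro p
    have h : φ p = leftHeavy p.2 ∨ φ p = rightHeavy p.2 := by
      simp only [φ]
      split_ifs <;> simp
    rcases h with h | h <;> rw [h] <;> rfl
  have hinj : Function.Injective fun p => isoBlockEmb e p.1 (φ p) := by
    intro p q h
    have h1 := isoBlockEmb_injective e (a₁ := (p.1, φ p)) (a₂ := (q.1, φ q)) h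
    obtain ⟨h2, h3⟩ := Prod.ext_iff.1 h1
    refine Prod.ext h2 (Fin.ext ?_)
    rw [← hcopy, ← hcopy]
    exact congrArg (fun z : Block t W => z.2.val) h3
  have hsub : (Finset.univ.image fun p => isoBlockEmb e p.1 (φ p)) ⊆ α := by
    intro u hu
    obtain ⟨p, -, rfl⟩ := Finset.mem_image.1 hu
    simp only [φ]
    split_ifs with h
    · exact h
    · have hadj := adj_isoBlockEmb e p.1
        (blockPath_adj_of_heavy (x := leftHeavy p.2) (y := rightHeavy p.2) rfl rfl)
      exact (hα hadj).resolve_left h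
  simpa [Finset.card_image_of_injective _ hinj] using Finset.card_le_card hsub

variable [Fintype V]

/-- All nodes, except for the copies in each block of a heavy position. -/
def avoiding (e : G ≃g blockCycle K t W r) (h : Fin W → Block t W) : Finset V :=
  (Finset.univ.image fun p : Fin K × Fin W => isoBlockEmb e p.1 (h p.2))ᶜ

lemma isoBlockEmb_mem_avoiding (e : G ≃g blockCycle K t W r) {h : Fin W → Block t W} {k : Fin K}
    {x : Block t W} : isoBlockEmb e k x ∈ avoiding e h ↔ ∀ c, h c ≠ x := by
  simp only [avoiding, Finset.mem_compl, Finset.mem_image, Finset.mem_univ, true_and, not_exists]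
  constructor
  · intro hx c hc
    exact hx (k, c) (by rw [hc])
  · intro hx p hp
    exact hx p.2 (Prod.ext_iff.1 (isoBlockEmb_injective e (a₁ := (p.1, h p.2)) (a₂ := (k, x)) hp)).2

lemma card_avoiding_add (e : G ≃g blockCycle K t W r) {h : Fin W → Block t W}
    (hh : Function.Injective h) : (avoiding e h).card + K * W = Fintype.card V := by
  have hinj : Function.Injective fun p : Fin K × Fin W => isoBlockEmb e p.1 (h p.2) :=
    (isoBlockEmb_injective e).comp (Function.injective_id.prodMap hh)
  have h1 := Finset.card_compl_add_card
    (Finset.univ.image fun p : Fin K × Fin W => isoBlockEmb e p.1 (h p.2))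
  rw [Finset.card_image_of_injective _ hinj] at h1
  simpa [avoiding] using h1

lemma isVertexCover_avoiding (e : G ≃g blockCycle K t W r) {h : Fin W → Block t W} {o : ℕ}
    (ho : 1 ≤ o) (ho' : o + 2 ≤ 2 * t + 4) (hh : ∀ c, (h c).1.val = o) :
    G.IsVertexCover (avoiding e h : Set V) := by
  intro u v huv
  by_contra! hcon
  obtain ⟨hu, hv⟩ := hcon
  simp only [avoiding, Finset.mem_coe, Finset.mem_compl, not_not, Finset.mem_image,
    Finset.mem_univ, true_and] at hu hv
  obtain ⟨p, rfl⟩ := hu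
  obtain ⟨q, rfl⟩ := hv
  obtain ⟨y, hy, hyq⟩ := exists_of_adj_isoBlockEmb e p.1 (by rw [hh]; exact ho)
    (by rw [hh]; exact ho') huv
  have h1 := isoBlockEmb_injective e (a₁ := (p.1, y)) (a₂ := (q.1, h q.2)) hyq
  obtain rfl : y = h q.2 := (Prod.ext_iff.1 h1).2
  rw [reductionGraph_adj, SimpleGraph.pathGraph_adj, hh, hh] at hy
  omega

/-! ### The lower bound. -/

/-- With many IDs, no algorithm computes in `t` rounds schedules of length at most `L` whose cost
is less than the number of heavy nodes. -/
lemma not_computesMonotone {j R : ℕ} (e : G ≃g blockCycle (2 ^ j) t W r) (hW : 0 < W) {η L : ℝ}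
    (hη : η * ((Fintype.card V : ℝ) - 2 ^ j * W) < 2 * (2 ^ j * W)) (hcard : Fintype.card V ≤ R)
    (hR : 7 ^ j * (2 * W + 2 * t + 2 + (⌊L⌋₊ + 1) + 1) ≤ R) (A : LocalAlgorithm (Fin R))
    {𝒢 : Set (SimpleGraph V)} (hG : G ∈ 𝒢) : ¬ A.ComputesMonotone t η 0 L 𝒢 := by
  intro hA
  set α := avoiding e rightHeavy with hα
  set β := avoiding e leftHeavy with hβ
  let α' : Finset (Block t W) := Finset.univ.filter fun x => ∀ c, rightHeavy c ≠ x
  let β' : Finset (Block t W) := Finset.univ.filter fun x => ∀ c, leftHeavy c ≠ x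
  have hαc : G.IsVertexCover (α : Set V) :=
    isVertexCover_avoiding e (o := t + 2) (by omega) (by omega) fun _ => rfl
  have hβc : G.IsVertexCover (β : Set V) :=
    isVertexCover_avoiding e (o := t + 1) (by omega) (by omega) fun _ => rfl
  have hαn : α.card + 2 ^ j * W = Fintype.card V := card_avoiding_add e rightHeavy_injective
  have hβn : β.card + 2 ^ j * W = Fintype.card V := card_avoiding_add e leftHeavy_injective
  -- The algorithm is simulated on an isolated block, so this depends only on the IDs `h` inside the
  -- block.
  let present : (Block t W → Fin R) → ℕ → Prop := fun h i => ∀ x : Block t W,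
    x.1.val = t + 1 ∨ x.1.val = t + 2 → A.output (A.state (blockPath t W) α' β' h t x) i = true
  have hpresent : ∀ (ids : V → Fin R) (k : Fin (2 ^ j)) (i : ℕ),
      present (ids ∘ isoBlockEmb e k) i ↔ ∀ x : Block t W, x.1.val = t + 1 ∨ x.1.val = t + 2 →
        isoBlockEmb e k x ∈ A.schedule G α β ids t i := by
    intro ids k i
    refine forall_congr' fun x => imp_congr_right fun hx => ?_
    rw [LocalAlgorithm.schedule, Finset.mem_filter,
      state_eq_of_local A G (blockPath t W) (isoBlockEmb e k)
      -- For `r = t` this leaves exactly the heavy positions `t + 1` and `t + 2`, which explains the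
      -- block length `2 * t + 4`.
      (fun r x => r + 1 ≤ x.1.val ∧ x.1.val + r + 2 ≤ 2 * t + 4) ?_
      (fun x y h => adj_isoBlockEmb e k h)
      (fun r x hx u hu => exists_of_adj_isoBlockEmb e k (by omega) (by omega) hu) α β α' β'
      (fun x => by simp [α', hα, isoBlockEmb_mem_avoiding])
      (fun x => by simp [β', hβ, isoBlockEmb_mem_avoiding]) ids t x (by omega)]
    · simp
    · intro r x hx
      refine ⟨by omega, fun y hy => ?_⟩
      rw [reductionGraph_adj, SimpleGraph.pathGraph_adj] at hy
      omega
  have hrun : ∀ ids : V → Fin R, Function.Injective ids → ∃ ℓ s : ℕ, (ℓ : ℝ) ≤ L ∧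
      IsSchedule G α β ℓ s (A.schedule G α β ids t) ∧ (s : ℝ) < 2 * (2 ^ j * W) ∧
      ∀ k, ∃ i < ℓ, present (ids ∘ isoBlockEmb e k) i := by
    intro ids hids
    obtain ⟨ℓ, hℓ, ⟨s, hS, hs⟩, -⟩ := hA G hG α β hαc hβc ids hids
    refine ⟨ℓ, s, hℓ, hS, ?_, fun k => ?_⟩
    · rw [show max α.card β.card = α.card by omega, add_zero] at hs
      have : (α.card : ℝ) = (Fintype.card V : ℝ) - 2 ^ j * W := by
        rw [← hαn]
        push_cast
        ring
      rw [this] at hs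
      exact hs.trans_lt hη
    · have hPQ : ∀ x ∈ isoBlockEmb e k '' {x | x.1.val = t + 1},
          ∀ y ∈ isoBlockEmb e k '' {x | x.1.val = t + 2}, G.Adj x y := by
        rintro _ ⟨x, hx, rfl⟩ _ ⟨y, hy, rfl⟩
        exact adj_isoBlockEmb e k (blockPath_adj_of_heavy hx hy)
      have hP : ∀ x ∈ isoBlockEmb e k '' {x | x.1.val = t + 1}, x ∈ α := by
        rintro _ ⟨x, hx, rfl⟩
        rw [hα, isoBlockEmb_mem_avoiding]
        rintro c rfl
        have : t + 2 = t + 1 := hx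
        omega
      have hP' : ∃ x ∈ isoBlockEmb e k '' {x | x.1.val = t + 1}, x ∉ β := by
        refine ⟨_, ⟨leftHeavy ⟨0, hW⟩, rfl, rfl⟩, fun h => ?_⟩
        rw [hβ, isoBlockEmb_mem_avoiding] at h
        exact h _ rfl
      obtain ⟨i, hi, hmem⟩ := exists_superset_of_isSchedule hS hPQ hP hP'
      refine ⟨i, hi, (hpresent ids k i).2 fun x hx => hmem _ ?_⟩
      exact hx.imp (fun h => ⟨x, h, rfl⟩) (fun h => ⟨x, h, rfl⟩)
  have henum : ∀ X : Finset (Fin R), ∃ h : Block t W → Fin R, X.card = 2 * W + 2 * t + 2 →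
      Function.Injective h ∧ ∀ x, h x ∈ X := by
    intro X
    by_cases hX : X.card = 2 * W + 2 * t + 2
    · have f : Block t W ≃ X := Fintype.equivOfCardEq (by rw [card_block, Fintype.card_coe, hX])
      exact ⟨fun x => f x, fun _ => ⟨Subtype.val_injective.comp f.injective, fun x => (f x).2⟩⟩
    · have : 0 < R := by
        have : 0 < 7 ^ j := by positivity
        exact lt_of_lt_of_le (by positivity) hR
      exact ⟨fun _ => ⟨0, this⟩, fun h => absurd h hX⟩
  choose enum henum using henum
  -- The earliest time at which a block carrying the IDs `X`, in a fixed arrangement, is full. For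
  -- `X` of block size this time exists and is less than the length of the schedule, because the
  -- arrangement extends to an ID assignment of the whole graph; the value `sInf ∅ = 0` never
  -- matters.
  let color : Finset (Fin R) → ℕ := fun X => sInf {i | present (enum X) i}
  have hcolor : ∀ X : Finset (Fin R), X.card = 2 * W + 2 * t + 2 → color X < ⌊L⌋₊ + 1 := by
    intro X hX
    let k : Fin (2 ^ j) := ⟨0, by positivity⟩
    obtain ⟨ids, hids, hids'⟩ := exists_injective_extension (φ := isoBlockEmb e k) (h := enum X)
      (fun x y h => (Prod.ext_iff.1
        (isoBlockEmb_injective e (a₁ := (k, x)) (a₂ := (k, y)) h)).2)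
      (henum X hX).1 (by simpa using hcard)
    obtain ⟨ℓ, s, hℓ, -, -, hpres⟩ := hrun ids hids
    obtain ⟨i, hi, hki⟩ := hpres k
    rw [hids'] at hki
    have h1 : color X ≤ i := Nat.sInf_le hki
    have h2 : ℓ ≤ ⌊L⌋₊ := Nat.le_floor hℓ
    omega
  obtain ⟨F, c, hF, hdis⟩ := exists_pairwise_disjoint_same_color j _ color hcolor Finset.univ
    (by simpa using hR)
  -- One global assignment that gives block `k` the IDs `F k`: all blocks are then full at the
  -- common time `c`.
  obtain ⟨ids, hids, hids'⟩ := exists_injective_extension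
    (φ := fun p : Fin (2 ^ j) × Block t W => isoBlockEmb e p.1 p.2)
    (h := fun p => enum (F p.1) p.2) (isoBlockEmb_injective e) (by
      rintro ⟨k, x⟩ ⟨k', y⟩ h
      have hk := henum _ (hF k k.isLt).1
      have hk' := henum _ (hF k' k'.isLt).1
      have h' : enum (F k) x = enum (F k') y := h
      obtain rfl : k = k' := by
        by_contra hne
        exact Finset.disjoint_left.1 (hdis k k.isLt k' k'.isLt fun h => hne (Fin.ext h)) (hk.2 x)
          (h' ▸ hk'.2 y)
      rw [hk.1 h']) (by simpa using hcard)
  obtain ⟨ℓ, s, -, hS, hs, hpres⟩ := hrun ids hids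
  have hcomp : ∀ k : Fin (2 ^ j), ids ∘ isoBlockEmb e k = enum (F k) := fun k =>
    funext fun x => congrFun hids' (k, x)
  have hc : ∀ k : Fin (2 ^ j), present (ids ∘ isoBlockEmb e k) c ∧ c < ℓ := by
    intro k
    obtain ⟨i, hi, hki⟩ := hpres k
    rw [hcomp] at hki ⊢
    have hck : sInf {i | present (enum (F k)) i} = c := (hF k k.isLt).2
    refine ⟨?_, ?_⟩
    · rw [← hck]
      exact Nat.sInf_mem (s := {i | present (enum (F k)) i}) ⟨i, hki⟩
    · rw [← hck]
      exact (Nat.sInf_le (s := {i | present (enum (F k)) i}) hki).trans_lt hi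
  have hcℓ : c < ℓ := (hc ⟨0, by positivity⟩).2
  let φ : Fin (2 ^ j) × (Fin W ⊕ Fin W) → V := fun p =>
    isoBlockEmb e p.1 (Sum.elim leftHeavy rightHeavy p.2)
  have hφ : Function.Injective φ := by
    refine (isoBlockEmb_injective e).comp (Function.injective_id.prodMap
      (Function.Injective.sumElim leftHeavy_injective rightHeavy_injective fun a b h => ?_))
    have : t + 1 = t + 2 := congrArg (fun z : Block t W => z.1.val) h
    omega
  have hsub : Finset.univ.image φ ⊆
      A.schedule G α β ids t c ∪ A.schedule G α β ids t (c + 1) := by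
    intro u hu
    obtain ⟨⟨k, a⟩, -, rfl⟩ := Finset.mem_image.1 hu
    refine Finset.mem_union_left _ ((hpresent ids k c).1 (hc k).1 _ ?_)
    cases a
    · exact Or.inl rfl
    · exact Or.inr rfl
  have h1 := (Finset.card_le_card hsub).trans (hS.cost c hcℓ)
  rw [Finset.card_image_of_injective _ hφ] at h1
  simp only [Finset.card_univ, Fintype.card_prod, Fintype.card_fin, Fintype.card_sum] at h1
  have h2 : ((2 ^ j * (W + W) : ℕ) : ℝ) ≤ s := by exact_mod_cast h1
  push_cast at h2
  linarith

/-- Every pair of vertex covers of a cycle of sufficiently many blocks has a cheap monotone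
schedule. -/
lemma exists_monotone_approxSchedule (e : G ≃g blockCycle K t W r) (hK : 0 < K) (hr : r + 1 ≤ W)
    {ε : ℝ} (hε : 3 ≤ ε * K) {α β : Finset V} (hα : G.IsVertexCover (α : Set V))
    (hβ : G.IsVertexCover (β : Set V)) :
    ∃ (ℓ : ℕ) (S : ℕ → Finset V), IsApproxSchedule G α β (1 + ε) 0 ℓ S ∧ IsMonotone ℓ S := by
  have hfib : ∀ p, (Finset.univ.filter fun x : V => (e x).1 = p).card ≤ W := by
    intro p
    refine le_trans ?_ (cycleWeight_le hr p)
    have hsub : ((Finset.univ.filter fun x : V => (e x).1 = p).image e) ⊆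
        Finset.univ.image fun i : Fin (cycleWeight K t W r p) => ⟨p, i⟩ := by
      intro z hz
      obtain ⟨x, hx, rfl⟩ := Finset.mem_image.1 hz
      obtain rfl := (Finset.mem_filter.1 hx).2
      exact Finset.mem_image.2 ⟨(e x).2, Finset.mem_univ _, rfl⟩
    have h := (Finset.card_le_card hsub).trans Finset.card_image_le
    rwa [Finset.card_image_of_injective _ e.injective, Finset.card_univ, Fintype.card_fin] at h
  obtain ⟨ℓ, S, hS, hmono⟩ := exists_monotone_schedule G (m := K * (2 * t + 4) + 1)
    (by have := Nat.mul_pos hK (show 0 < 2 * t + 4 by omega); omega) (fun x => (e x).1)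
    (fun x y hxy => reductionGraph_adj.1 (e.map_rel_iff.2 hxy)) hfib hα hβ
  refine ⟨ℓ, S, ⟨_, hS, ?_⟩, hmono⟩
  have h1 : ((K * W : ℕ) : ℝ) ≤ (max α.card β.card : ℕ) := by
    exact_mod_cast le_max_of_le_left (mul_le_card_of_isVertexCover e hα)
  have hε0 : 0 ≤ ε := by
    by_contra! h
    have : ε * K ≤ 0 := mul_nonpos_of_nonpos_of_nonneg h.le (Nat.cast_nonneg _)
    linarith
  have h2 := mul_le_mul_of_nonneg_left h1 hε0
  have h3 := mul_le_mul_of_nonneg_right hε (Nat.cast_nonneg (α := ℝ) W)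
  push_cast at h2 ⊢
  linarith

end Cycle

/-- The `n`-node reduction graphs of cycles of `K` blocks in which the light nodes are few. -/
def blockCycleFamily (K : ℕ) (ε : ℝ) (t : ℕ → ℕ) (n : ℕ) : Set (SimpleGraph (Fin n)) :=
  {G | ∃ W r : ℕ, 0 < W ∧ r + 1 ≤ W ∧
    (2 * (K * (2 * t n + 2) + (r + 1) : ℕ) : ℝ) ≤ ε * (K * W) ∧
    Nonempty (G ≃g blockCycle K (t n) W r)}

lemma blockCycleFamily_nonempty {K n : ℕ} (hK : 0 < K) {ε : ℝ} (hε : 0 < ε) (hε' : ε ≤ 1)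
    {t : ℕ → ℕ} (ht : (t n : ℝ) ≤ ε / (20 * K) * n) (hn : 100 * (K : ℝ) ^ 2 / ε ≤ n) :
    (blockCycleFamily K ε t n).Nonempty := by
  have hK1 : (1 : ℝ) ≤ K := by exact_mod_cast hK
  have hn' : 100 * (K : ℝ) ^ 2 ≤ ε * n := by rwa [div_le_iff₀' hε] at hn
  have ht' : 20 * (K * t n : ℝ) ≤ ε * n := by
    have := mul_le_mul_of_nonneg_left ht (show (0 : ℝ) ≤ 20 * K by positivity)
    have h2 : (20 * K : ℝ) * (ε / (20 * K) * n) = ε * n := by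
      field_simp
    linarith
  have hεn : ε * n ≤ n := mul_le_of_le_one_left (Nat.cast_nonneg _) hε'
  have hKK : (K : ℝ) ≤ (K : ℝ) ^ 2 := by nlinarith
  have hle : K * (2 * t n + 2) + 1 ≤ n := by
    have : ((K * (2 * t n + 2) + 1 : ℕ) : ℝ) ≤ n := by
      push_cast
      nlinarith
    exact_mod_cast this
  set a := n - 1 - K * (2 * t n + 2) with ha
  have hdm := Nat.div_add_mod a (2 * K)
  have hmod := Nat.mod_lt a (show 0 < 2 * K by omega)
  set W := a / (2 * K) with hW
  set r := a % (2 * K) with hr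
  have hn1 : n = 2 * K * W + r + 1 + K * (2 * t n + 2) := by omega
  have hn2 : (n : ℝ) = 2 * K * W + r + 1 + K * (2 * t n + 2) := by exact_mod_cast hn1
  have hr2 : (r : ℝ) + 1 ≤ 2 * K := by exact_mod_cast hmod
  have hKW : 4 / 5 * (n : ℝ) ≤ 2 * (K * W) := by nlinarith
  have hrW : r + 1 ≤ W := by
    have h1 : (40 * K : ℝ) ≤ W := by
      have h2 : (K : ℝ) * (40 * K) ≤ K * W := by nlinarith
      exact le_of_mul_le_mul_left h2 (by linarith)
    have h2 : ((r + 1 : ℕ) : ℝ) ≤ W := by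
      push_cast
      linarith
    exact_mod_cast h2
  have hcard : Fintype.card (Fin n)
      = Fintype.card (Σ v : Fin (K * (2 * t n + 4) + 1), Fin (cycleWeight K (t n) W r v)) := by
    rw [card_blockCycle, Fintype.card_fin]
    linarith
  let f := Fintype.equivOfCardEq hcard
  refine ⟨(blockCycle K (t n) W r).comap f, W, r, by omega, hrW, ?_, ⟨SimpleGraph.Iso.comap f _⟩⟩
  have h3 : ε * (4 / 5 * n) ≤ ε * (2 * (K * W)) := mul_le_mul_of_nonneg_left hKW hε.le
  push_cast
  nlinarith

end VCReconfig

theorem theorem54 (ε : ℝ) (hε₀ : 0 < ε) (hε₁ : ε < 1) (t : ℕ → ℕ)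
    (ht : (fun n : ℕ => (t n : ℝ)) =o[atTop] (fun n : ℕ => (n : ℝ))) :
    ∃ 𝒢 : (n : ℕ) → Set (SimpleGraph (Fin n)),
      (∀ n, ∀ G ∈ 𝒢 n, VCReconfig.IsWeightedCycleReduction G) ∧
      (∀ᶠ n in atTop, (𝒢 n).Nonempty) ∧
      (∀ᶠ n in atTop, ∀ G ∈ 𝒢 n, ∀ α β : Finset (Fin n),
        G.IsVertexCover (α : Set (Fin n)) → G.IsVertexCover (β : Set (Fin n)) →
          ∃ (ℓ : ℕ) (S : ℕ → Finset (Fin n)),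
            VCReconfig.IsApproxSchedule G α β (1 + ε) 0 ℓ S ∧ VCReconfig.IsMonotone ℓ S) ∧
      (∀ C : ℝ, 0 < C → ∀ c : ℝ, 0 < c → ∀ᶠ n : ℕ in atTop,
        ∀ R : ℕ, c * (n : ℝ) ^ 2 ≤ R → ∀ A : VCReconfig.LocalAlgorithm (Fin R),
          ¬ A.ComputesMonotone (t n) (2 - ε) 0 (C * n) (𝒢 n)) := by
  open VCReconfig in
  obtain ⟨j, hj⟩ := pow_unbounded_of_one_lt (3 / ε) (one_lt_two : (1 : ℝ) < 2)
  have hK : 0 < 2 ^ j := by positivity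
  have hKε : 3 ≤ ε * ((2 ^ j : ℕ) : ℝ) := by
    rw [div_lt_iff₀' hε₀] at hj
    push_cast
    exact hj.le
  have hne : ∀ᶠ n in atTop, (blockCycleFamily (2 ^ j) ε t n).Nonempty := by
    have hδ : (0 : ℝ) < ε / (20 * (2 ^ j : ℕ)) := by positivity
    filter_upwards [ht.bound hδ, tendsto_natCast_atTop_atTop.eventually_ge_atTop
      (100 * ((2 ^ j : ℕ) : ℝ) ^ 2 / ε)] with n hn hn'
    exact blockCycleFamily_nonempty hK hε₀ hε₁.le (by simpa using hn) hn'
  refine ⟨blockCycleFamily (2 ^ j) ε t, ?_, hne, ?_, ?_⟩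
  · rintro n G ⟨W, r, hW, -, -, he⟩
    refine ⟨_, _, ?_, cycleWeight_pos hW, he⟩
    have := Nat.mul_le_mul hK (show 4 ≤ 2 * t n + 4 by omega)
    omega
  · refine Eventually.of_forall ?_
    rintro n G ⟨W, r, -, hr, -, ⟨e⟩⟩ α β hα hβ
    exact exists_monotone_approxSchedule e hK hr hKε hα hβ
  · intro C hC c hc
    filter_upwards [hne, eventually_ge_atTop 1, tendsto_natCast_atTop_atTop.eventually_ge_atTop
      ((1 + 7 ^ j * (3 + C)) / c)] with n hn hn1 hn2 R hR A
    obtain ⟨G, hG⟩ := hn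
    obtain ⟨W, r, hW, -, hlight, ⟨e⟩⟩ := id hG
    have hcard := card_eq_of_iso e
    have hcard' : (Fintype.card (Fin n) : ℝ) = 2 ^ j * (2 * W + 2 * t n + 2) + (r + 1) := by
      exact_mod_cast hcard
    rw [Fintype.card_fin] at hcard
    have hn1' : (1 : ℝ) ≤ n := by exact_mod_cast hn1
    have hRn : (1 + 7 ^ j * (3 + C)) * n ≤ (R : ℝ) := by
      rw [div_le_iff₀' hc] at hn2
      calc (1 + 7 ^ j * (3 + C)) * n ≤ c * n * n :=
            mul_le_mul_of_nonneg_right hn2 (Nat.cast_nonneg _)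
        _ = c * (n : ℝ) ^ 2 := by ring
        _ ≤ R := hR
    have h7 : (0 : ℝ) ≤ 7 ^ j := by positivity
    refine not_computesMonotone e hW ?_ ?_ ?_ A hG
    · rw [hcard']
      push_cast at hlight
      have hpos : 0 < ε * (2 ^ j * (2 * (t n : ℝ) + 2) + ((r : ℝ) + 1)) := by positivity
      linarith
    · rw [Fintype.card_fin]
      have : (n : ℝ) ≤ R := by nlinarith [mul_nonneg h7 (show 0 ≤ (3 + C) * n by positivity)]
      exact_mod_cast this
    · have hs : 2 * W + 2 * t n + 2 ≤ n := by
        have := Nat.le_mul_of_pos_left (2 * W + 2 * t n + 2) hK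
        omega
      have hs' : ((2 * W + 2 * t n + 2 : ℕ) : ℝ) ≤ n := by exact_mod_cast hs
      have hfl := Nat.floor_le (show 0 ≤ C * (n : ℝ) by positivity)
      have h1 : ((2 * W + 2 * t n + 2 + (⌊C * (n : ℝ)⌋₊ + 1) + 1 : ℕ) : ℝ) ≤ (3 + C) * n := by
        push_cast at hs' ⊢
        linarith
      have h2 := mul_le_mul_of_nonneg_left h1 h7
      have h3 : ((7 ^ j * (2 * W + 2 * t n + 2 + (⌊C * (n : ℝ)⌋₊ + 1) + 1) : ℕ) : ℝ) ≤ R := by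
        rw [Nat.cast_mul, Nat.cast_pow]
        push_cast at h2 ⊢
        linarith
      exact_mod_cast h3
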